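/- Let $X=\{1,\ldots,m\}^{\mathbb N}$ with the one-sided shift $\sigma$ and the Bernoulli measure $\mathbf p=(p_1,\ldots,p_m)^{\mathbb N}$, where $p_j>0$ for all $j$ and $\sum_j p_j=1$. Let $\underline A=(A_1,\ldots,A_m)\in \mathrm{Mat}(d,\mathbb R)^m$ satisfy $\operatorname{rank}(A_j)=k$ for all $j$ and $$\Theta_k(\underline A):=\min_{1\le i,j\le m}\|\wedge_k(A_iA_j)\|>0,$$ where $\wedge_k B$ is the matrix of $k\times k$ minors of $B$ and $\|\cdot\|$ is the Euclidean operator norm. Let $M_1,\ldots,M_m$ be $d\times k$ real matrices with $M_i^tM_i=I$ and $\mathrm{Range}(M_i)=\mathrm{Range}(A_i)$, and put $C_{i,j}:=M_i^tA_iM_j$. Consider the maps $$F(\omega,v)=(\sigma\omega,A_{\omega_0}v)\ \text{ on } X\times\mathbb R^d,\qquad \tilde F(\omega,v)=(\sigma\omega,C_{\omega_1,\omega_0}v)\ \text{ on } X\times\mathbb R^k,$$ and $H:X\times\mathbb R^k\to X\times\mathbb R^d$, $H(\omega,v)=(\sigma\omega,M_{\omega_0}v)$. Then $C_{i,j}\in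 GL(k,\mathbb R)$ for all $i,j$, and $F\circ H=H\circ\tilde F$. Moreover, for $i=1,\ldots,k$, the Lyapunov exponents $L_i(F)$ and $L_i(\tilde F)$ exist in $[-\infty,\infty]$ and $L_i(F)=L_i(\tilde F)$. Here, for a linear cocycle $(x,v)\mapsto(\sigma x,B(x)v)$ over $(X,\sigma,\mathbf p)$ with iterates $B^n(x)=B(\sigma^{n-1}x)\cdots B(\sigma x)B(x)$, the exponent $L_i$ is the $\mathbf p$-almost sure constant limit $\lim_{n\to\infty}\frac1n\log s_i(B^n(x))$, where $s_1\ge s_2\ge\cdots\ge 0$ are the singular values and $\log 0=-\infty$. -/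

import Mathlib

open MeasureTheory Filter Topology

noncomputable section

namespace ConstRank

/-! ### Linear cocycles -/

/-- The skew product `(x, v) ↦ (T x, A x v)` on `X × ℝ^d`. -/
def skewProduct {X : Type*} {d : ℕ} (T : X → X) (A : X → Matrix (Fin d) (Fin d) ℝ) :
    X × (Fin d → ℝ) → X × (Fin d → ℝ) :=
  fun z => (T z.1, (A z.1).mulVec z.2)

/-- The iterates `A^n(x) = A(T^{n-1} x) ⋯ A(T x) A(x)`. -/
def iter {X : Type*} {d : ℕ} (T : X → X) (A : X → Matrix (Fin d) (Fin d) ℝ) :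
    ℕ → X → Matrix (Fin d) (Fin d) ℝ
  | 0, _ => 1
  | n + 1, x => A (T^[n] x) * iter T A n x

/-- The singular values of a matrix in decreasing order with multiplicity, indexed from `0`
(so the value at `i` is `s_{i+1}` in the usual numbering). -/
def singularValue {d : ℕ} (B : Matrix (Fin d) (Fin d) ℝ) (i : ℕ) : ℝ :=
  (Matrix.toEuclideanLin B).singularValues i

/-- `L` is the Lyapunov exponent number `i` (counted from `0`) of the cocycle `(T, A)`:
for `μ`-almost every `x`, `(1/n) log s(A^n(x))` tends to `L`, where `s` is the singular value
number `i`.  Everything takes place in `[-∞, ∞]`, with `log 0 = -∞`. -/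
def IsLyapunovExponent {X : Type*} [MeasurableSpace X] {d : ℕ} (μ : Measure X) (T : X → X)
    (A : X → Matrix (Fin d) (Fin d) ℝ) (i : ℕ) (L : EReal) : Prop :=
  ∀ᵐ x ∂μ, Tendsto
    (fun n : ℕ => ENNReal.log (ENNReal.ofReal (singularValue (iter T A n x) i)) / (n : EReal))
    atTop (𝓝 L)

/-! ### The Bernoulli shift -/

/-- The one-sided shift on sequences of symbols. -/
def shift {m : ℕ} (ω : ℕ → Fin m) : ℕ → Fin m := fun n => ω (n + 1)

/-- The probability measure on the symbols with weights `p`. -/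
def symbolMeasure {m : ℕ} (p : stdSimplex ℝ (Fin m)) : Measure (Fin m) :=
  ∑ j, ENNReal.ofReal (p.1 j) • Measure.dirac j

instance {m : ℕ} (p : stdSimplex ℝ (Fin m)) : IsProbabilityMeasure (symbolMeasure p) := by
  constructor
  have h : ∑ j, ENNReal.ofReal (p.1 j) = 1 := by
    rw [← ENNReal.ofReal_sum_of_nonneg (fun j _ => p.2.1 j), p.2.2, ENNReal.ofReal_one]
  simpa [symbolMeasure] using h

/-- The Bernoulli measure `p^ℕ` on sequences of symbols. -/
def bernoulli {m : ℕ} (p : stdSimplex ℝ (Fin m)) : Measure (ℕ → Fin m) :=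
  Measure.infinitePi fun _ => symbolMeasure p

/-- The matrix-valued function `ω ↦ A_{ω_0}` of a random cocycle. -/
def randomCocycle {m d : ℕ} (A : Fin m → Matrix (Fin d) (Fin d) ℝ) (ω : ℕ → Fin m) :
    Matrix (Fin d) (Fin d) ℝ := A (ω 0)

/-! ### Exterior powers and `Θ_k` -/

/-- The `k`-th exterior power of a matrix: the matrix of its `k × k` minors, indexed by the
`k`-element subsets of the index set. -/
def exteriorPower {d : ℕ} (k : ℕ) (B : Matrix (Fin d) (Fin d) ℝ) :
    Matrix {I : Finset (Fin d) // I.card = k} {I : Finset (Fin d) // I.card = k} ℝ :=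
  Matrix.of fun I J => (B.submatrix (I.1.orderEmbOfFin I.2) (J.1.orderEmbOfFin J.2)).det

open scoped Matrix.Norms.L2Operator in
/-- `Θ_k(A)`: the minimum over all `i, j` of the operator norm (with respect to Euclidean norms)
of `∧_k (A_i A_j)`. -/
def theta {m d : ℕ} (k : ℕ) (A : Fin m → Matrix (Fin d) (Fin d) ℝ) : ℝ :=
  ⨅ ij : Fin m × Fin m, ‖exteriorPower k (A ij.1 * A ij.2)‖

/-! ### The reduced cocycle -/

/-- `M_i` has orthonormal columns and the same range as `A_i`, for every `i`. -/
structure IsRangeFrame {m d k : ℕ} (A : Fin m → Matrix (Fin d) (Fin d) ℝ)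
    (M : Fin m → Matrix (Fin d) (Fin k) ℝ) : Prop where
  orthogonal : ∀ i, (M i).transpose * M i = 1
  range_eq : ∀ i, LinearMap.range (M i).mulVecLin = LinearMap.range (A i).mulVecLin

/-- `C_{i,j} = M_i^t A_i M_j`. -/
def reducedMatrix {m d k : ℕ} (A : Fin m → Matrix (Fin d) (Fin d) ℝ)
    (M : Fin m → Matrix (Fin d) (Fin k) ℝ) (i j : Fin m) : Matrix (Fin k) (Fin k) ℝ :=
  (M i).transpose * A i * M j

/-- The function `ω ↦ C_{ω_1, ω_0}`. -/
def reducedCocycle {m d k : ℕ} (A : Fin m → Matrix (Fin d) (Fin d) ℝ)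
    (M : Fin m → Matrix (Fin d) (Fin k) ℝ) (ω : ℕ → Fin m) : Matrix (Fin k) (Fin k) ℝ :=
  reducedMatrix A M (ω 1) (ω 0)

/-- `H(ω, v) = (σ ω, M_{ω_0} v)`. -/
def semiconjugacy {m d k : ℕ} (M : Fin m → Matrix (Fin d) (Fin k) ℝ) :
    (ℕ → Fin m) × (Fin k → ℝ) → (ℕ → Fin m) × (Fin d → ℝ) :=
  fun z => (shift z.1, (M (z.1 0)).mulVec z.2)

end ConstRank

end

/-! The matrix `M i * (M i)ᵀ` fixes the range of `A i`, so `M i * C i j = A i * M j`. This gives the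
semiconjugacy, and also two factorizations in which only the outer factors differ from the iterates:
A^{n+1}(ω) = M_{ω_n} C^n(ω) (M_{ω_0}ᵗ A_{ω_0}) and C^n(ω) = M_{ω_nᵗ} A^{n+1}(ω) (M_{ω_0}
C_{ω_0,ω_0}⁻¹), with M_{ω_nᵗ} denoting the transpose of M_{ω_n}. The outer factors are bounded
uniformly in n. So any submultiplicative size, such as the norm of the action on alternating j-forms
(`compoundNorm`), grows at the same exponential rate for both cocycles. That norm is comparable to
s_1⋯s_j, and differences of consecutive rates give the individual exponents.

Invertibility of `C i j` holds because a nonzero k × k minor of `A i * A j`, supplied by Θ_k > 0, is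
a product of determinants one of which is det `C i j`.

Existence of the rates is needed for C only. As C takes finitely many invertible values, the
logarithms of the norms form a subadditive process with bounded increments reading finitely many
symbols (`IsBoundedSubadditive`). For such processes the subadditive ergodic theorem is proved
directly. The lower limit of g_n/n is shift invariant, hence a constant c. A greedy decomposition
along good times gives ∫ g_n ≤ (c + ε) n + R. Cutting [0, n) into disjoint blocks and applying the
strong law to the independent block terms bounds the upper limit by c. All exponents with index
below k are therefore finite. -/

open MeasureTheory Filter Topology

noncomputable section

namespace ConstRank

/-! ### Alternating forms and products of singular values -/

section ExteriorNorm

variable {E F G : Type*}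
  [NormedAddCommGroup E] [InnerProductSpace ℝ E]
  [NormedAddCommGroup F] [InnerProductSpace ℝ F]
  [NormedAddCommGroup G] [InnerProductSpace ℝ G]

/-- The operator norm of the pullback by `T` on continuous alternating `j`-forms. -/
def pullbackNorm (j : ℕ) (T : E →L[ℝ] F) : ℝ :=
  ‖(ContinuousAlternatingMap.compContinuousLinearMapCLM T :
    (F [⋀^Fin j]→L[ℝ] ℝ) →L[ℝ] (E [⋀^Fin j]→L[ℝ] ℝ))‖

lemma pullbackNorm_nonneg (j : ℕ) (T : E →L[ℝ] F) : 0 ≤ pullbackNorm j T := by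
  unfold pullbackNorm
  positivity

lemma norm_compContinuousLinearMap_le_pullbackNorm {j : ℕ} (T : E →L[ℝ] F)
    (f : F [⋀^Fin j]→L[ℝ] ℝ) :
    ‖f.compContinuousLinearMap T‖ ≤ pullbackNorm j T * ‖f‖ :=
  ContinuousLinearMap.le_opNorm
    (ContinuousAlternatingMap.compContinuousLinearMapCLM T :
      (F [⋀^Fin j]→L[ℝ] ℝ) →L[ℝ] (E [⋀^Fin j]→L[ℝ] ℝ)) f

lemma pullbackNorm_le_of_forall {j : ℕ} {T : E →L[ℝ] F} {c : ℝ} (hc : 0 ≤ c)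
    (h : ∀ f : F [⋀^Fin j]→L[ℝ] ℝ, ‖f.compContinuousLinearMap T‖ ≤ c * ‖f‖) :
    pullbackNorm j T ≤ c :=
  ContinuousLinearMap.opNorm_le_bound _ hc h

lemma pullbackNorm_comp_le (j : ℕ) (S : F →L[ℝ] G) (T : E →L[ℝ] F) :
    pullbackNorm j (S ∘L T) ≤ pullbackNorm j S * pullbackNorm j T := by
  refine pullbackNorm_le_of_forall
    (mul_nonneg (pullbackNorm_nonneg _ _) (pullbackNorm_nonneg _ _)) fun f => ?_
  calc ‖f.compContinuousLinearMap (S ∘L T)‖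
      = ‖(f.compContinuousLinearMap S).compContinuousLinearMap T‖ := rfl
    _ ≤ pullbackNorm j T * ‖f.compContinuousLinearMap S‖ :=
        norm_compContinuousLinearMap_le_pullbackNorm _ _
    _ ≤ pullbackNorm j T * (pullbackNorm j S * ‖f‖) := by
        gcongr
        · exact pullbackNorm_nonneg _ _
        · exact norm_compContinuousLinearMap_le_pullbackNorm _ _
    _ = _ := by ring

/-- The alternating form `w ↦ det ⟪u a, w b⟫`. -/
def gramForm {j : ℕ} (u : Fin j → F) : F [⋀^Fin j]→ₗ[ℝ] ℝ :=
  (Matrix.detRowAlternating (n := Fin j) (R := ℝ)).compLinearMap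
    (LinearMap.pi fun a => (innerₗ F (u a)))

lemma gramForm_apply {j : ℕ} (u w : Fin j → F) :
    gramForm u w = (Matrix.of fun b a => inner ℝ (u a) (w b)).det := rfl

lemma norm_gramForm_apply_le {j : ℕ} (u w : Fin j → F) (hu : ∀ a, ‖u a‖ ≤ 1) :
    ‖gramForm u w‖ ≤ (j.factorial : ℝ) * ∏ b, ‖w b‖ := by
  rw [gramForm_apply, Matrix.det_apply]
  refine (norm_sum_le _ _).trans ?_
  refine (Finset.sum_le_card_nsmul _ _ (∏ b, ‖w b‖) ?_).trans ?_
  · intro σ _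
    have h : ‖Equiv.Perm.sign σ • ∏ i, (Matrix.of fun b a => inner ℝ (u a) (w b)) (σ i) i‖
        = ∏ i, ‖inner ℝ (u i) (w (σ i))‖ := by
      rcases Int.units_eq_one_or (Equiv.Perm.sign σ) with h | h <;> simp [h]
    rw [h, ← Equiv.prod_comp σ (fun b => ‖w b‖)]
    refine Finset.prod_le_prod (fun _ _ => norm_nonneg _) fun i _ => ?_
    refine (norm_inner_le_norm _ _).trans ?_
    exact mul_le_of_le_one_left (norm_nonneg _) (hu i)
  · simp [Finset.card_univ, Fintype.card_perm]

variable [FiniteDimensional ℝ E] [FiniteDimensional ℝ F]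

/-- An orthonormal basis of right singular vectors. -/
lemma exists_orthonormalBasis_inner_map (T : E →ₗ[ℝ] F) :
    ∃ e : OrthonormalBasis (Fin (Module.finrank ℝ E)) ℝ E, ∀ a b,
      inner ℝ (T (e a)) (T (e b)) = if a = b then T.singularValues a ^ 2 else 0 := by
  -- The eigenbasis of T*T, whose eigenvalues are the squared singular values.
  refine ⟨T.isSymmetric_adjoint_comp_self.eigenvectorBasis rfl, fun a b => ?_⟩
  rw [← LinearMap.adjoint_inner_left, ← LinearMap.comp_apply,
    T.isSymmetric_adjoint_comp_self.apply_eigenvectorBasis rfl, T.sq_singularValues_fin rfl,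
    inner_smul_left]
  split_ifs with h
  · subst h; simp
  · simp [h]

lemma norm_map_eq_singularValues {T : E →ₗ[ℝ] F}
    {e : OrthonormalBasis (Fin (Module.finrank ℝ E)) ℝ E}
    (he : ∀ a b, inner ℝ (T (e a)) (T (e b)) = if a = b then T.singularValues a ^ 2 else 0)
    (a : Fin (Module.finrank ℝ E)) : ‖T (e a)‖ = T.singularValues a := by
  have h := he a a
  rw [real_inner_self_eq_norm_sq, if_pos rfl] at h
  exact (sq_eq_sq₀ (norm_nonneg _) (T.singularValues_nonneg _)).1 h

theorem prod_singularValues_le_pullbackNorm (j : ℕ) (T : E →L[ℝ] F) :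
    ∏ i ∈ Finset.range j, (T : E →ₗ[ℝ] F).singularValues i
      ≤ (j.factorial : ℝ) * pullbackNorm j T := by
  set s := (T : E →ₗ[ℝ] F).singularValues with hs
  -- A vanishing factor makes the claim trivial; otherwise `j` is at most the dimension and the
  -- singular values can be inverted.
  by_cases h0 : ∃ i ∈ Finset.range j, s i = 0
  · rw [Finset.prod_eq_zero_iff.2 h0]
    exact mul_nonneg (by positivity) (pullbackNorm_nonneg _ _)
  push Not at h0
  have hj : ∀ a : Fin j, (a : ℕ) < Module.finrank ℝ E := by
    intro a
    by_contra! h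
    exact h0 a (Finset.mem_range.2 a.2) (LinearMap.singularValues_of_finrank_le _ h)
  obtain ⟨e, he⟩ := exists_orthonormalBasis_inner_map (T : E →ₗ[ℝ] F)
  let ι : Fin j → Fin (Module.finrank ℝ E) := fun a => ⟨a, hj a⟩
  have hι : Function.Injective ι := fun a b h => Fin.ext (by simpa [ι] using h)
  -- Unit left singular vectors: their Gram form, evaluated on the images of the right singular
  -- vectors, is a diagonal determinant with entries `s a`.
  let u : Fin j → F := fun a => (s a)⁻¹ • T (e (ι a))
  have hpos : ∀ a : Fin j, 0 < s a := fun a =>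
    lt_of_le_of_ne (LinearMap.singularValues_nonneg _ _) (h0 a (Finset.mem_range.2 a.2)).symm
  have hu : ∀ a, ‖u a‖ ≤ 1 := by
    intro a
    have h1 : ‖T (e (ι a))‖ = s a := norm_map_eq_singularValues he (ι a)
    simp only [u, norm_smul, h1, norm_inv, Real.norm_of_nonneg (hpos a).le]
    exact (inv_mul_cancel₀ (hpos a).ne').le
  let f : F [⋀^Fin j]→L[ℝ] ℝ := (gramForm u).mkContinuous (j.factorial : ℝ)
    fun w => norm_gramForm_apply_le u w hu
  have hf : ‖f‖ ≤ (j.factorial : ℝ) :=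
    AlternatingMap.mkContinuous_norm_le _ (by positivity) _
  have hval : f.compContinuousLinearMap T (fun a => e (ι a)) = ∏ a : Fin j, s a := by
    change gramForm u (fun a => T (e (ι a))) = _
    rw [gramForm_apply]
    have : (Matrix.of fun b a => inner ℝ (u a) (T (e (ι b)))) =
        Matrix.diagonal (fun a : Fin j => s a) := by
      ext b a
      have h1 : inner ℝ (T (e (ι a))) (T (e (ι b))) = if ι a = ι b then s (ι a) ^ 2 else 0 :=
        he (ι a) (ι b)
      simp only [Matrix.of_apply, u, inner_smul_left, h1, hι.eq_iff]
      by_cases hab : a = b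
      · subst hab
        have := (hpos a).ne'
        simp only [if_true, Matrix.diagonal_apply_eq, ι]
        simp
        field_simp
      · simp [hab, Matrix.diagonal_apply_ne _ (Ne.symm hab)]
    rw [this, Matrix.det_diagonal]
  calc ∏ i ∈ Finset.range j, s i = ∏ a : Fin j, s a := (Fin.prod_univ_eq_prod_range _ j).symm
    _ ≤ ‖f.compContinuousLinearMap T (fun a => e (ι a))‖ := by rw [hval]; exact le_abs_self _
    _ ≤ ‖f.compContinuousLinearMap T‖ * ∏ a, ‖e (ι a)‖ := ContinuousAlternatingMap.le_opNorm _ _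
    _ = ‖f.compContinuousLinearMap T‖ := by simp
    _ ≤ pullbackNorm j T * ‖f‖ := norm_compContinuousLinearMap_le_pullbackNorm _ _
    _ ≤ pullbackNorm j T * j.factorial := by gcongr; exact pullbackNorm_nonneg _ _
    _ = _ := mul_comm _ _

/-- Among products of `j` terms of a nonnegative antitone sequence with distinct indices, the
product of the first `j` terms is the largest. -/
lemma prod_le_prod_range_of_antitone {s : ℕ → ℝ} (hs : Antitone s) (h0 : ∀ i, 0 ≤ s i)
    (S : Finset ℕ) : ∏ i ∈ S, s i ≤ ∏ i ∈ Finset.range S.card, s i := by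
  rw [← Fin.prod_univ_eq_prod_range, ← Finset.prod_coe_sort,
    ← Equiv.prod_comp (S.orderIsoOfFin rfl).toEquiv]
  refine Finset.prod_le_prod (fun _ _ => h0 _) fun a _ => hs ?_
  -- A strictly increasing enumeration of naturals satisfies a ≤ S_a.
  have : StrictMono fun a : Fin S.card => ((S.orderIsoOfFin rfl a : S) : ℕ) :=
    fun a b h => (S.orderIsoOfFin rfl).strictMono h
  obtain ⟨a, ha⟩ := a
  induction a with
  | zero => exact Nat.zero_le _
  | succ b ih =>
    have hb : b < S.card := by omega
    exact (Nat.succ_le_succ (ih hb (Finset.mem_univ _))).trans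
      (this (a := ⟨b, hb⟩) (b := ⟨b + 1, ha⟩) (Nat.lt_succ_self b))

theorem pullbackNorm_le_prod_singularValues (j : ℕ) (T : E →L[ℝ] F) :
    pullbackNorm j T ≤ (Module.finrank ℝ E : ℝ) ^ j *
      ∏ i ∈ Finset.range j, (T : E →ₗ[ℝ] F).singularValues i := by
  set s := (T : E →ₗ[ℝ] F).singularValues with hs
  have hs0 : ∀ i, 0 ≤ s i := LinearMap.singularValues_nonneg _
  have hP : 0 ≤ ∏ i ∈ Finset.range j, s i := Finset.prod_nonneg fun i _ => hs0 i
  obtain ⟨e, he⟩ := exists_orthonormalBasis_inner_map (T : E →ₗ[ℝ] F)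
  refine pullbackNorm_le_of_forall (by positivity) fun f => ?_
  refine ContinuousAlternatingMap.opNorm_le_bound _ (by positivity) fun v => ?_
  -- Expanding every argument in the right singular basis gives (dim E)^j terms, the source of the
  -- constant.
  have hexp : f.compContinuousLinearMap T v =
      ∑ r : Fin j → Fin (Module.finrank ℝ E),
        (∏ i, inner ℝ (e (r i)) (v i)) * f (fun i => T (e (r i))) := by
    have h1 : ∀ i, T (v i) = ∑ a, inner ℝ (e a) (v i) • T (e a) := by
      intro i
      conv_lhs => rw [← e.sum_repr' (v i)]
      simp
    change f (fun i => T (v i)) = _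
    simp_rw [h1]
    have h2 := MultilinearMap.map_sum f.toContinuousMultilinearMap.toMultilinearMap
      (fun i a => inner ℝ (e a) (v i) • T (e a))
    refine h2.trans (Finset.sum_congr rfl fun r _ => ?_)
    exact MultilinearMap.map_smul_univ f.toContinuousMultilinearMap.toMultilinearMap
      (fun i => inner ℝ (e (r i)) (v i)) (fun i => T (e (r i)))
  rw [hexp]
  refine (norm_sum_le _ _).trans ?_
  refine (Finset.sum_le_card_nsmul _ _
    ((∏ i ∈ Finset.range j, s i) * ‖f‖ * ∏ i, ‖v i‖) fun r _ => ?_).trans ?_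
  · rw [norm_mul, norm_prod]
    have hv : ∏ i, ‖inner ℝ (e (r i)) (v i)‖ ≤ ∏ i, ‖v i‖ := by
      refine Finset.prod_le_prod (fun _ _ => norm_nonneg _) fun i _ => ?_
      simpa using norm_inner_le_norm (𝕜 := ℝ) (e (r i)) (v i)
    have hfr : ‖f (fun i => T (e (r i)))‖ ≤ (∏ i ∈ Finset.range j, s i) * ‖f‖ := by
      -- Repeated indices kill the term by alternation; distinct ones give a product of `j` distinct
      -- singular values.
      by_cases hr : Function.Injective r
      · refine (f.le_opNorm _).trans ?_
        rw [mul_comm]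
        gcongr
        have hn : ∀ i, ‖T (e (r i))‖ = s (r i) := fun i => norm_map_eq_singularValues he (r i)
        simp_rw [hn]
        have hinj : Function.Injective fun i => ((r i : Fin _) : ℕ) := Fin.val_injective.comp hr
        have := prod_le_prod_range_of_antitone (LinearMap.singularValues_antitone
          (T : E →ₗ[ℝ] F)) hs0 (Finset.univ.image fun i => ((r i : Fin _) : ℕ))
        rwa [Finset.prod_image hinj.injOn, Finset.card_image_of_injective _ hinj,
          Finset.card_univ, Fintype.card_fin] at this
      · have : f (fun i => T (e (r i))) = 0 := by
          simp only [Function.Injective, not_forall] at hr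
          obtain ⟨a, b, hab, hne⟩ := hr
          exact f.map_eq_zero_of_eq _ (by simp only [hab]) hne
        rw [this, norm_zero]; positivity
    calc _ ≤ (∏ i, ‖v i‖) * ((∏ i ∈ Finset.range j, s i) * ‖f‖) :=
          mul_le_mul hv hfr (norm_nonneg _) (Finset.prod_nonneg fun _ _ => norm_nonneg _)
      _ = _ := by ring
  · simp only [Finset.card_univ, Fintype.card_fun, Fintype.card_fin, nsmul_eq_mul, Nat.cast_pow]
    exact le_of_eq (by ring)

end ExteriorNorm

/-! ### Ergodicity of the Bernoulli shift -/

section BernoulliShift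

open ProbabilityTheory

variable {m : ℕ}

lemma shift_iterate_apply (a : ℕ) (ω : ℕ → Fin m) (i : ℕ) : shift^[a] ω i = ω (i + a) := by
  induction a generalizing ω with
  | zero => rfl
  | succ a ih => rw [Function.iterate_succ_apply, ih, shift]; congr 1

lemma measurable_shift : Measurable (shift : (ℕ → Fin m) → ℕ → Fin m) :=
  measurable_pi_lambda _ fun i => measurable_pi_apply (i + 1)

instance (p : stdSimplex ℝ (Fin m)) : IsProbabilityMeasure (bernoulli p) := by
  unfold bernoulli
  infer_instance

lemma measurePreserving_shift (p : stdSimplex ℝ (Fin m)) :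
    MeasurePreserving shift (bernoulli p) (bernoulli p) :=
  ⟨measurable_shift,
    Measure.map_infinitePi_infinitePi_of_inj (P := fun _ : ℕ => symbolMeasure p)
      (f := fun i : ℕ => i + 1) (add_left_injective 1)⟩

lemma iIndepFun_eval (p : stdSimplex ℝ (Fin m)) :
    iIndepFun (fun (i : ℕ) (ω : ℕ → Fin m) => ω i) (bernoulli p) :=
  iIndepFun_infinitePi (P := fun _ : ℕ => symbolMeasure p) (X := fun _ x => x)
    fun _ => measurable_id

/-- Shift-invariant events have probability zero or one. -/
lemma preErgodic_shift (p : stdSimplex ℝ (Fin m)) : PreErgodic shift (bernoulli p) := by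
  refine ⟨fun s hs hinv => ?_⟩
  have hlim : MeasurableSet[limsup (fun i : ℕ => MeasurableSpace.comap
      (fun ω : ℕ → Fin m => ω i) inferInstance) atTop] s := by
    rw [limsup_eq_iInf_iSup_of_nat, MeasurableSpace.measurableSet_iInf]
    intro n
    -- Invariance exhibits `s` as an event about the coordinates from `n` on, for every `n`: a tail
    -- event, so Kolmogorov's zero-one law applies.
    have hn : shift^[n] ⁻¹' s = s := by
      rw [Set.preimage_iterate_eq]
      exact Function.iterate_fixed hinv n
    rw [← hn]
    suffices hmeas : Measurable[⨆ i, ⨆ (_ : i ≥ n), MeasurableSpace.comap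
      (fun ω : ℕ → Fin m => ω i) inferInstance, inferInstance] (shift^[n] : (ℕ → Fin m) → _) from
      hmeas hs
    refine @measurable_pi_lambda _ _ _ (_) _ _ fun i => ?_
    have : (fun ω : ℕ → Fin m => shift^[n] ω i) = fun ω => ω (i + n) :=
      funext fun ω => shift_iterate_apply n ω i
    rw [this]
    refine Measurable.mono (comap_measurable _) ?_ le_rfl
    exact le_iSup₂_of_le (i + n) (Nat.le_add_left n i) le_rfl
  rcases measure_zero_or_one_of_measurableSet_limsup_atTop
    (fun i => (measurable_pi_apply i).comap_le) (iIndepFun_eval p).iIndep hlim with h | h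
  · rw [eventuallyConst_set']
    exact Or.inl (ae_eq_empty.2 h)
  · rw [eventuallyConst_set']
    exact Or.inr ((ae_eq_univ_iff_measure_eq hs.nullMeasurableSet).2 (by rw [h, measure_univ]))

/-- Sequences with vanishing difference have the same inferior limit. -/
lemma liminf_le_liminf_of_tendsto_sub {u v : ℕ → ℝ}
    (hu : IsBoundedUnder (· ≥ ·) atTop u) (hv : IsBoundedUnder (· ≤ ·) atTop v)
    (h : Tendsto (fun n => u n - v n) atTop (𝓝 0)) : liminf u atTop ≤ liminf v atTop := by
  refine le_of_forall_lt fun c hc => ?_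
  obtain ⟨c', hcc', hc'⟩ := exists_between hc
  obtain ⟨c'', h1, h2⟩ := exists_between hcc'
  refine h1.trans_le (le_liminf_of_le hv.isCoboundedUnder_ge ?_)
  filter_upwards [eventually_lt_of_lt_liminf hc' hu,
    h.eventually (gt_mem_nhds (sub_pos.2 h2))] with n hn hn'
  linarith

/-- A subadditive process over the shift with bounded increments, whose `n`-th term is a function
of the first `n + 1` symbols. -/
structure IsBoundedSubadditive (g : ℕ → (ℕ → Fin m) → ℝ) (K : ℝ) : Prop where
  subadd : ∀ a b ω, g (a + b) ω ≤ g a ω + g b (shift^[a] ω)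
  increment : ∀ n ω, |g (n + 1) ω - g n (shift ω)| ≤ K
  zero : ∀ ω, |g 0 ω| ≤ K
  dependsOn : ∀ n, DependsOn (g n) (Set.Iic n)

/-! ### Subadditive ergodic theorem for bounded processes -/

namespace IsBoundedSubadditive

variable {g : ℕ → (ℕ → Fin m) → ℝ} {K : ℝ}

lemma abs_le (hg : IsBoundedSubadditive g K) (n : ℕ) (ω : ℕ → Fin m) :
    |g n ω| ≤ K * (n + 1) := by
  induction n generalizing ω with
  | zero => simpa using hg.zero ω
  | succ n ih =>
    have h1 := _root_.abs_le.1 (hg.increment n ω)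
    have h2 := _root_.abs_le.1 (ih (shift ω))
    push_cast
    exact _root_.abs_le.2 ⟨by linarith, by linarith⟩

lemma exists_factor (hg : IsBoundedSubadditive g K) (n : ℕ) :
    ∃ h : (Fin (n + 1) → Fin m) → ℝ, ∀ ω, g n ω = h fun i => ω i := by
  have : Function.FactorsThrough (g n) (fun (ω : ℕ → Fin m) (i : Fin (n + 1)) => ω i) := by
    intro ω ω' h
    refine hg.dependsOn n fun i hi => ?_
    exact congrFun h ⟨i, Nat.lt_succ_of_le hi⟩
  obtain ⟨h, hh⟩ := (Function.factorsThrough_iff _).1 this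
  exact ⟨h, fun ω => congrFun hh ω⟩

lemma measurable (hg : IsBoundedSubadditive g K) (n : ℕ) : Measurable (g n) := by
  obtain ⟨h, hh⟩ := hg.exists_factor n
  rw [funext hh]
  exact (Measurable.of_discrete (f := h)).comp
    (measurable_pi_lambda _ fun i => measurable_pi_apply _)

lemma integrable (hg : IsBoundedSubadditive g K) (p : stdSimplex ℝ (Fin m)) (n : ℕ) :
    Integrable (g n) (bernoulli p) :=
  Integrable.of_bound (hg.measurable n).aestronglyMeasurable (K * (n + 1))
    (ae_of_all _ fun ω => hg.abs_le n ω)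

lemma nonneg_of_point (hg : IsBoundedSubadditive g K) (ω : ℕ → Fin m) : 0 ≤ K :=
  (abs_nonneg _).trans (hg.zero ω)

lemma abs_div_le (hg : IsBoundedSubadditive g K) (n : ℕ) (ω : ℕ → Fin m) :
    |g n ω / n| ≤ 2 * K := by
  have hK := hg.nonneg_of_point ω
  rcases n.eq_zero_or_pos with rfl | hn
  · simpa using hK
  have hn' : (1 : ℝ) ≤ n := by exact_mod_cast hn
  rw [abs_div, Nat.abs_cast, div_le_iff₀ (by linarith)]
  nlinarith [hg.abs_le n ω]

lemma isBoundedUnder_le (hg : IsBoundedSubadditive g K) (ω : ℕ → Fin m) :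
    IsBoundedUnder (· ≤ ·) atTop fun n : ℕ => g n ω / n :=
  isBoundedUnder_of ⟨2 * K, fun n => (_root_.abs_le.1 (hg.abs_div_le n ω)).2⟩

lemma isBoundedUnder_ge (hg : IsBoundedSubadditive g K) (ω : ℕ → Fin m) :
    IsBoundedUnder (· ≥ ·) atTop fun n : ℕ => g n ω / n :=
  isBoundedUnder_of ⟨-(2 * K), fun n => (_root_.abs_le.1 (hg.abs_div_le n ω)).1⟩

lemma tendsto_sub_shift (hg : IsBoundedSubadditive g K) (ω : ℕ → Fin m) :
    Tendsto (fun n : ℕ => g (n + 1) ω / ((n + 1 : ℕ) : ℝ) - g n (shift ω) / n) atTop (𝓝 0) := by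
  have hK := hg.nonneg_of_point ω
  -- 3K = K + 2K: the increment bound plus the bound on g_n/n.
  have hz : Tendsto (fun n : ℕ => 3 * K * (1 / ((n : ℝ) + 1))) atTop (𝓝 0) := by
    simpa using tendsto_one_div_add_atTop_nhds_zero_nat.const_mul (3 * K)
  refine squeeze_zero_norm (fun n => ?_) hz
  have h1 := hg.increment n ω
  have h2 := hg.abs_div_le n (shift ω)
  have hn : (0 : ℝ) < n + 1 := by positivity
  -- At n = 0 division by zero returns 0, so only g_1 remains, and it is at most 2K.
  rcases n.eq_zero_or_pos with rfl | hpos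
  · have h3 := hg.zero (shift ω)
    have h4 : |g 1 ω| ≤ |g 1 ω - g 0 (shift ω)| + |g 0 (shift ω)| := by
      simpa using abs_add_le (g 1 ω - g 0 (shift ω)) (g 0 (shift ω))
    simp only [zero_add] at h1
    simp
    linarith
  have hn0 : (n : ℝ) ≠ 0 := by positivity
  have e : g (n + 1) ω / ((n + 1 : ℕ) : ℝ) - g n (shift ω) / n =
      ((g (n + 1) ω - g n (shift ω)) - g n (shift ω) / n) * (1 / ((n : ℝ) + 1)) := by
    push_cast
    field_simp
    ring
  rw [e, norm_mul, Real.norm_of_nonneg (by positivity : 0 ≤ 1 / ((n : ℝ) + 1))]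
  gcongr
  exact (norm_sub_le _ _).trans (by rw [Real.norm_eq_abs, Real.norm_eq_abs]; linarith)

lemma liminf_shift (hg : IsBoundedSubadditive g K) (ω : ℕ → Fin m) :
    liminf (fun n : ℕ => g n (shift ω) / n) atTop = liminf (fun n : ℕ => g n ω / n) atTop := by
  rw [← Filter.liminf_nat_add (fun n : ℕ => g n ω / n) 1]
  have hle : IsBoundedUnder (· ≤ ·) atTop fun n : ℕ => g (n + 1) ω / ((n + 1 : ℕ) : ℝ) :=
    isBoundedUnder_of ⟨2 * K, fun n => (_root_.abs_le.1 (hg.abs_div_le (n + 1) ω)).2⟩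
  have hge : IsBoundedUnder (· ≥ ·) atTop fun n : ℕ => g (n + 1) ω / ((n + 1 : ℕ) : ℝ) :=
    isBoundedUnder_of ⟨-(2 * K), fun n => (_root_.abs_le.1 (hg.abs_div_le (n + 1) ω)).1⟩
  have ht := hg.tendsto_sub_shift ω
  refine le_antisymm ?_ ?_
  · refine liminf_le_liminf_of_tendsto_sub (hg.isBoundedUnder_ge _) hle ?_
    simpa using ht.neg
  · exact liminf_le_liminf_of_tendsto_sub hge (hg.isBoundedUnder_le _) ht

lemma exists_ae_liminf_eq (hg : IsBoundedSubadditive g K) (p : stdSimplex ℝ (Fin m)) :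
    ∃ c : ℝ, ∀ᵐ ω ∂bernoulli p, liminf (fun n : ℕ => g n ω / n) atTop = c := by
  have hm : Measurable fun ω => liminf (fun n : ℕ => g n ω / n) atTop :=
    Measurable.liminf fun n => (hg.measurable n).div_const _
  obtain ⟨c, hc⟩ := (preErgodic_shift p).ae_eq_const_of_ae_eq_comp hm
    (funext fun ω => hg.liminf_shift ω)
  exact ⟨c, hc⟩

/-- Greedy decomposition: outside the set of points at which no return time up to `N` is
`a`-good, jump by a good time; inside it, jump by one. -/
lemma le_of_greedy (hg : IsBoundedSubadditive g K) {a R : ℝ} {N : ℕ} (hR : 0 ≤ R)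
    (hR' : 2 * K - a ≤ R) {B : Set (ℕ → Fin m)}
    (hB : ∀ ω, ω ∉ B → ∃ l, 1 ≤ l ∧ l ≤ N ∧ g l ω ≤ a * l) (n : ℕ) (ω : ℕ → Fin m) :
    g n ω ≤ a * n + R * (∑ i ∈ Finset.range n, B.indicator 1 (shift^[i] ω)) + R * N + K := by
  induction n using Nat.strong_induction_on generalizing ω with
  | _ n ih =>
  have hK := hg.nonneg_of_point ω
  have hind : ∀ i ω, (0 : ℝ) ≤ B.indicator 1 (shift^[i] ω) := fun i ω =>
    Set.indicator_nonneg (fun _ _ => zero_le_one) _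
  have hsum : ∀ j ω, (0 : ℝ) ≤ ∑ i ∈ Finset.range j, B.indicator 1 (shift^[i] ω) :=
    fun j ω => Finset.sum_nonneg fun i _ => hind i ω
  have hRs := mul_nonneg hR (hsum n ω)
  -- Short times are absorbed by the term R N + K, since K - a ≤ R.
  by_cases hn : n ≤ N
  · have h1 := (_root_.abs_le.1 (hg.abs_le n ω)).2
    have hn' : (n : ℝ) ≤ N := by exact_mod_cast hn
    have h2 : R * n ≤ R * N := mul_le_mul_of_nonneg_left hn' hR
    have h3 : (K - a) * n ≤ R * n := mul_le_mul_of_nonneg_right (by linarith) (Nat.cast_nonneg n)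
    linarith
  push Not at hn
  have split : ∀ l, l ≤ n → ∑ i ∈ Finset.range n, B.indicator (1 : (ℕ → Fin m) → ℝ) (shift^[i] ω) =
      ∑ i ∈ Finset.range l, B.indicator 1 (shift^[i] ω) +
      ∑ i ∈ Finset.range (n - l), B.indicator 1 (shift^[i] (shift^[l] ω)) := by
    intro l hl
    obtain ⟨q, rfl⟩ := Nat.exists_eq_add_of_le hl
    rw [Finset.sum_range_add, Nat.add_sub_cancel_left]
    congr 1
    refine Finset.sum_congr rfl fun i _ => ?_
    rw [← Function.iterate_add_apply, add_comm]
  -- A bad point costs g_1 ≤ 2K ≤ a + R, and its indicator pays the R. A good jump costs at most a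
  -- l, and the indicators it passes are discarded.
  by_cases hω : ω ∈ B
  · have h1 := hg.subadd 1 (n - 1) ω
    rw [Nat.add_sub_cancel' (by omega)] at h1
    have h2 := ih (n - 1) (by omega) (shift^[1] ω)
    have h3 := (_root_.abs_le.1 (hg.abs_le 1 ω)).2
    have h4 := split 1 (by omega)
    rw [Finset.sum_range_one, Function.iterate_zero_apply, Set.indicator_of_mem hω,
      Pi.one_apply] at h4
    rw [h4]
    rw [Nat.cast_sub (by omega : 1 ≤ n)] at h2
    push_cast at h2 h3
    linarith
  · obtain ⟨l, hl1, hlN, hl⟩ := hB ω hω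
    have h1 := hg.subadd l (n - l) ω
    rw [Nat.add_sub_cancel' (by omega)] at h1
    have h2 := ih (n - l) (by omega) (shift^[l] ω)
    have h4 := split l (by omega)
    have h5 := mul_nonneg hR (hsum l ω)
    rw [h4]
    rw [Nat.cast_sub (by omega : l ≤ n)] at h2
    linarith

/-- Integrate the greedy bound with a = c + ε/2. The sets of points without a good time up to N
decrease to a null set, so for large N their contribution per step fits into the other ε/2. -/
lemma exists_integral_le (hg : IsBoundedSubadditive g K) (p : stdSimplex ℝ (Fin m)) {c : ℝ}
    (hc : ∀ᵐ ω ∂bernoulli p, liminf (fun n : ℕ => g n ω / n) atTop = c) {ε : ℝ} (hε : 0 < ε) :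
    ∃ R : ℝ, ∀ n, ∫ ω, g n ω ∂bernoulli p ≤ (c + ε) * n + R := by
  set a := c + ε / 2 with ha
  let B : ℕ → Set (ℕ → Fin m) := fun N => {ω | ∀ l, 1 ≤ l → l ≤ N → a * l < g l ω}
  have hBm : ∀ N, MeasurableSet (B N) := by
    intro N
    have : B N = ⋂ l, ⋂ (_ : 1 ≤ l), ⋂ (_ : l ≤ N), {ω | a * l < g l ω} := by
      ext ω; simp [B]
    rw [this]
    exact MeasurableSet.iInter fun l => MeasurableSet.iInter fun _ => MeasurableSet.iInter
      fun _ => measurableSet_lt measurable_const (hg.measurable l)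
  have hBanti : Antitone B := fun N N' h ω hω l h1 h2 => hω l h1 (h2.trans h)
  -- A point in every `B N` has g_n/n > a for all n ≥ 1, so its lower limit exceeds c.
  have hB0 : bernoulli p (⋂ N, B N) = 0 := by
    refine measure_mono_null (t := {ω | ¬ liminf (fun n : ℕ => g n ω / n) atTop = c})
      (fun ω hω hlim => ?_) hc
    have : ∀ᶠ n : ℕ in atTop, a ≤ g n ω / n := by
      filter_upwards [eventually_ge_atTop 1] with n hn
      have hn' : (0 : ℝ) < n := by exact_mod_cast hn
      rw [le_div_iff₀ hn']
      exact (Set.mem_iInter.1 hω n n hn le_rfl).le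
    have := le_liminf_of_le (hg.isBoundedUnder_le ω).isCoboundedUnder_ge this
    rw [hlim] at this
    linarith
  have hBt := tendsto_measure_iInter_atTop (μ := bernoulli p)
    (fun N => (hBm N).nullMeasurableSet) hBanti ⟨0, measure_ne_top _ _⟩
  rw [hB0] at hBt
  have hBr : Tendsto (fun N => (bernoulli p).real (B N)) atTop (𝓝 0) := by
    exact (ENNReal.tendsto_toReal ENNReal.zero_ne_top).comp hBt
  set R := 2 * |K| + |a| with hR
  have hR0 : 0 ≤ R := by positivity
  have hR' : 2 * K - a ≤ R := by linarith [le_abs_self K, neg_abs_le a]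
  obtain ⟨N, hN⟩ : ∃ N, R * (bernoulli p).real (B N) < ε / 2 :=
    ((by simpa using hBr.const_mul R :
      Tendsto (fun N => R * (bernoulli p).real (B N)) atTop (𝓝 0)).eventually
        (gt_mem_nhds (half_pos hε))).exists
  refine ⟨R * N + K, fun n => ?_⟩
  have hgood : ∀ ω, ω ∉ B N → ∃ l, 1 ≤ l ∧ l ≤ N ∧ g l ω ≤ a * l := by
    intro ω hω
    simpa [B] using hω
  have hmp : ∀ i, MeasurePreserving (shift^[i]) (bernoulli p) (bernoulli p) :=
    fun i => (measurePreserving_shift p).iterate i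
  have hindint : ∀ i, Integrable (fun ω => (B N).indicator (1 : (ℕ → Fin m) → ℝ) (shift^[i] ω))
      (bernoulli p) := fun i =>
    (hmp i).integrable_comp_of_integrable
      ((integrable_const (1 : ℝ)).indicator (hBm N))
  have hindval : ∀ i, ∫ ω, (B N).indicator (1 : (ℕ → Fin m) → ℝ) (shift^[i] ω) ∂bernoulli p =
      (bernoulli p).real (B N) := by
    intro i
    rw [← integral_map (f := (B N).indicator (1 : (ℕ → Fin m) → ℝ)) (hmp i).measurable.aemeasurable
      (((stronglyMeasurable_const (b := (1 : ℝ))).indicator (hBm N)).aestronglyMeasurable),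
      (hmp i).map_eq, integral_indicator_one (hBm N)]
  have hsumint := integrable_finsetSum (Finset.range n) fun i _ => hindint i
  calc ∫ ω, g n ω ∂bernoulli p
      ≤ ∫ ω, (R * (∑ i ∈ Finset.range n, (B N).indicator 1 (shift^[i] ω))
          + (a * n + R * N + K)) ∂bernoulli p := by
        refine integral_mono (hg.integrable p n)
          ((hsumint.const_mul R).add (integrable_const _)) fun ω => ?_
        have := hg.le_of_greedy hR0 hR' hgood n ω
        dsimp only
        linarith
    _ = R * (n * (bernoulli p).real (B N)) + (a * n + R * N + K) := by
        rw [integral_add (hsumint.const_mul R) (integrable_const _), integral_const_mul,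
          integral_finsetSum _ fun i _ => hindint i]
        simp [hindval]
    _ ≤ (c + ε) * n + (R * N + K) := by
        have h1 : R * (bernoulli p).real (B N) * n ≤ ε / 2 * n :=
          mul_le_mul_of_nonneg_right hN.le (Nat.cast_nonneg n)
        rw [ha]
        linarith

/-- `g N` reads the N + 1 symbols 0, …, N. Translates by multiples of N + 1 thus read disjoint
coordinates and are independent and identically distributed. -/
lemma ae_tendsto_block_average (hg : IsBoundedSubadditive g K) (p : stdSimplex ℝ (Fin m))
    (N : ℕ) : ∀ᵐ ω ∂bernoulli p, Tendsto
      (fun j : ℕ => (∑ i ∈ Finset.range j, g N (shift^[i * (N + 1)] ω)) / j) atTop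
      (𝓝 (∫ ω, g N ω ∂bernoulli p)) := by
  have hmp : ∀ i, MeasurePreserving (shift^[i]) (bernoulli p) (bernoulli p) :=
    fun i => (measurePreserving_shift p).iterate i
  have h0 : (fun ω => g N (shift^[0 * (N + 1)] ω)) = g N := by
    funext ω; rw [zero_mul]; rfl
  have hlaw := strong_law_ae_real (μ := bernoulli p)
    (fun i ω => g N (shift^[i * (N + 1)] ω)) ?_ ?_ ?_
  · simpa using hlaw
  · simpa using hg.integrable p N
  · obtain ⟨h, hh⟩ := hg.exists_factor N
    intro i i' hii
    let S : ℕ → Finset ℕ := fun i => Finset.Ico (i * (N + 1)) (i * (N + 1) + (N + 1))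
    have hS : ∀ i (t : Fin (N + 1)), (t : ℕ) + i * (N + 1) ∈ S i := fun i t => by
      have := t.2
      simp only [S, Finset.mem_Ico]
      omega
    have hdisj : Disjoint (S i) (S i') := by
      rw [Finset.disjoint_left]
      intro x hx hx'
      have key : ∀ i, x ∈ S i → x / (N + 1) = i := by
        intro i hx
        simp only [S, Finset.mem_Ico] at hx
        rw [Nat.div_eq_iff N.add_one_pos]
        constructor <;> omega
      exact hii ((key i hx).symm.trans (key i' hx'))
    have hind := (iIndepFun_eval p).indepFun_finset (S i) (S i') hdisj
      fun j => measurable_pi_apply j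
    have hcomp := hind.comp
      (φ := fun y : S i → Fin m => h fun t => y ⟨t + i * (N + 1), hS i t⟩)
      (ψ := fun y : S i' → Fin m => h fun t => y ⟨t + i' * (N + 1), hS i' t⟩)
      Measurable.of_discrete Measurable.of_discrete
    have e : ∀ i, (fun ω => g N (shift^[i * (N + 1)] ω)) =
        (fun y : S i → Fin m => h fun t => y ⟨t + i * (N + 1), hS i t⟩) ∘
          fun (ω : ℕ → Fin m) (j : S i) => ω j := by
      intro i
      funext ω
      simp only [hh, Function.comp_apply, shift_iterate_apply]
    change IndepFun (fun ω => g N (shift^[i * (N + 1)] ω))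
      (fun ω => g N (shift^[i' * (N + 1)] ω)) (bernoulli p)
    rw [e i, e i']
    exact hcomp
  · intro i
    refine ⟨((hg.measurable N).comp (hmp _).measurable).aemeasurable,
      ((hg.measurable N).comp (hmp _).measurable).aemeasurable, ?_⟩
    rw [h0]
    change Measure.map (g N ∘ shift^[i * (N + 1)]) _ = _
    rw [← Measure.map_map (hg.measurable N) (hmp _).measurable, (hmp _).map_eq]

/-- A block has length N + 1 while the summand is `g N`; the missing step costs g_1 ≤ 2K per block.
-/
lemma le_sum_blocks (hg : IsBoundedSubadditive g K) (N r j : ℕ) (ω : ℕ → Fin m) :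
    g (j * (N + 1) + r) ω ≤
      ∑ i ∈ Finset.range j, g N (shift^[i * (N + 1)] ω) + 2 * K * j + K * (r + 1) := by
  induction j generalizing ω with
  | zero =>
    have := (_root_.abs_le.1 (hg.abs_le r ω)).2
    simpa using this
  | succ j ih =>
    have h1 := hg.subadd (N + 1) (j * (N + 1) + r) ω
    have h2 := hg.subadd N 1 ω
    have h3 := (_root_.abs_le.1 (hg.abs_le 1 (shift^[N] ω))).2
    have h4 := ih (shift^[N + 1] ω)
    have e : (j + 1) * (N + 1) + r = N + 1 + (j * (N + 1) + r) := by ring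
    rw [e, Finset.sum_range_succ']
    have hs : ∀ i, shift^[i * (N + 1)] (shift^[N + 1] ω) = shift^[(i + 1) * (N + 1)] ω := by
      intro i
      rw [← Function.iterate_add_apply, add_mul, one_mul]
    simp only [hs] at h4
    simp only [zero_mul, Function.iterate_zero_apply]
    push_cast at h3 ⊢
    linarith

lemma tendsto_natCast_div_div (b : ℕ) (hb : b ≠ 0) :
    Tendsto (fun n : ℕ => ((n / b : ℕ) : ℝ) / n) atTop (𝓝 (1 / b)) := by
  have h := (tendsto_nat_floor_mul_div_atTop (R := ℝ) (a := 1 / b) (by positivity)).comp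
    tendsto_natCast_atTop_atTop
  refine h.congr fun n => ?_
  simp only [Function.comp_apply]
  rw [one_div_mul_eq_div, Nat.floor_div_natCast, Nat.floor_natCast]

lemma eventually_lt_of_integral_lt (hg : IsBoundedSubadditive g K) {e q : ℝ} {N : ℕ}
    {ω : ℕ → Fin m} (hω : Tendsto
      (fun j : ℕ => (∑ i ∈ Finset.range j, g N (shift^[i * (N + 1)] ω)) / j) atTop (𝓝 e))
    (hq : e + 2 * K < q * (N + 1)) : ∀ᶠ n : ℕ in atTop, g n ω / n < q := by
  have hK := hg.nonneg_of_point ω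
  have hdiv := Nat.tendsto_div_const_atTop (n := N + 1) (Nat.succ_ne_zero N)
  have h1 := hω.comp hdiv
  have h2 := tendsto_natCast_div_div (N + 1) (Nat.succ_ne_zero N)
  have h3 : Tendsto (fun n : ℕ => K * (N + 2) / (n : ℝ)) atTop (𝓝 0) :=
    tendsto_const_div_atTop_nhds_zero_nat _
  have h4 := ((h1.add_const (2 * K)).mul h2).add h3
  have hlt : (e + 2 * K) * (1 / ((N + 1 : ℕ) : ℝ)) + 0 < q := by
    have : (0 : ℝ) < N + 1 := by positivity
    push_cast
    rw [add_zero, mul_one_div, div_lt_iff₀ this]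
    exact hq
  filter_upwards [h4.eventually (gt_mem_nhds hlt), eventually_ge_atTop (N + 1)] with n hn hnN
  refine lt_of_le_of_lt ?_ hn
  have hn0 : (0 : ℝ) < n := by
    have : 0 < n := by omega
    exact_mod_cast this
  have hj0 : (0 : ℝ) < ((n / (N + 1) : ℕ) : ℝ) := by
    have : 0 < n / (N + 1) := Nat.div_pos hnN (Nat.succ_pos N)
    exact_mod_cast this
  have hb := hg.le_sum_blocks N (n % (N + 1)) (n / (N + 1)) ω
  rw [Nat.div_add_mod' n (N + 1)] at hb
  have hr : ((n % (N + 1) : ℕ) : ℝ) + 1 ≤ N + 2 := by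
    have : n % (N + 1) + 1 ≤ N + 2 := by
      have := Nat.mod_lt n N.add_one_pos
      omega
    exact_mod_cast this
  have hr' := mul_le_mul_of_nonneg_left hr hK
  simp only [Function.comp_apply]
  rw [div_le_iff₀ hn0]
  have e2 : (((∑ i ∈ Finset.range (n / (N + 1)), g N (shift^[i * (N + 1)] ω)) /
      ((n / (N + 1) : ℕ) : ℝ) + 2 * K) * (((n / (N + 1) : ℕ) : ℝ) / n) + K * (N + 2) / n) * n =
      (∑ i ∈ Finset.range (n / (N + 1)), g N (shift^[i * (N + 1)] ω)) +
        2 * K * ((n / (N + 1) : ℕ) : ℝ) + K * (N + 2) := by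
    field_simp
  rw [e2]
  linarith

/-- The subadditive ergodic theorem for bounded processes over a Bernoulli shift. -/
theorem exists_ae_tendsto (hg : IsBoundedSubadditive g K) (p : stdSimplex ℝ (Fin m)) :
    ∃ L : ℝ, ∀ᵐ ω ∂bernoulli p, Tendsto (fun n : ℕ => g n ω / n) atTop (𝓝 L) := by
  obtain ⟨c, hc⟩ := hg.exists_ae_liminf_eq p
  refine ⟨c, ?_⟩
  filter_upwards [hc, ae_all_iff.2 fun N => hg.ae_tendsto_block_average p N] with ω hω hav
  refine tendsto_order.2 ⟨fun q hq => ?_, fun q hq => ?_⟩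
  · exact eventually_lt_of_lt_liminf (hω.symm ▸ hq) (hg.isBoundedUnder_ge ω)
  · obtain ⟨R, hR⟩ := hg.exists_integral_le p hc (half_pos (sub_pos.2 hq))
    -- With ε = (q - c)/2, this is exactly (c + ε) N + R + 2K < q (N + 1).
    obtain ⟨N, hN⟩ := exists_nat_gt ((R + 2 * K - q) / ((q - c) / 2))
    rw [div_lt_iff₀ (half_pos (sub_pos.2 hq))] at hN
    refine hg.eventually_lt_of_integral_lt (hav N) ?_
    have := hR N
    linarith

end IsBoundedSubadditive

end BernoulliShift

/-! ### Exponential growth rates -/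

section LogAsymptotics

/-- Comparable positive sequences have the same exponential growth rate. -/
lemma tendsto_log_div_of_comparable {x y : ℕ → ℝ} {c c' l : ℝ} (hc : 0 < c)
    (hx : ∀ᶠ n in atTop, 0 < x n) (hxy : ∀ᶠ n in atTop, x n ≤ c * y n)
    (hyx : ∀ᶠ n in atTop, y n ≤ c' * x n)
    (h : Tendsto (fun n : ℕ => Real.log (x n) / n) atTop (𝓝 l)) :
    Tendsto (fun n : ℕ => Real.log (y n) / n) atTop (𝓝 l) := by
  have hlow : Tendsto (fun n : ℕ => Real.log (x n) / n - Real.log c / n) atTop (𝓝 l) := by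
    simpa using h.sub (tendsto_const_div_atTop_nhds_zero_nat (Real.log c))
  have hup : Tendsto (fun n : ℕ => Real.log (x n) / n + Real.log c' / n) atTop (𝓝 l) := by
    simpa using h.add (tendsto_const_div_atTop_nhds_zero_nat (Real.log c'))
  have hy : ∀ᶠ n in atTop, 0 < y n := by
    filter_upwards [hx, hxy] with n h1 h2
    exact pos_of_mul_pos_right (h1.trans_le h2) hc.le
  refine tendsto_of_tendsto_of_tendsto_of_le_of_le' hlow hup ?_ ?_
  · filter_upwards [hx, hxy, hy] with n h1 h2 h3
    rw [← sub_div]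
    gcongr
    have := Real.log_le_log h1 h2
    rw [Real.log_mul hc.ne' h3.ne'] at this
    linarith
  · filter_upwards [hx, hyx, hy] with n h1 h2 h3
    rw [← add_div]
    gcongr
    have hc' : 0 < c' := pos_of_mul_pos_left (h3.trans_le h2) h1.le
    have := Real.log_le_log h3 h2
    rw [Real.log_mul hc'.ne' h1.ne'] at this
    linarith

/-- Absorbs the lag of one step between A^{n+1} and C^n. -/
lemma tendsto_div_of_tendsto_succ_div {y : ℕ → ℝ} {l : ℝ}
    (h : Tendsto (fun n : ℕ => y (n + 1) / n) atTop (𝓝 l)) :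
    Tendsto (fun n : ℕ => y n / n) atTop (𝓝 l) := by
  rw [← tendsto_add_atTop_iff_nat 1]
  have h1 : Tendsto (fun n : ℕ => y (n + 1) / n * ((n : ℝ) / (n + 1))) atTop (𝓝 l) := by
    simpa using h.mul (tendsto_natCast_div_add_atTop (1 : ℝ))
  refine h1.congr' ?_
  filter_upwards [eventually_ge_atTop 1] with n hn
  have : (n : ℝ) ≠ 0 := by positivity
  push_cast
  field_simp

end LogAsymptotics

/-! ### Matrix norms on alternating forms -/

section CompoundNorm

variable {a b c d : ℕ}

/-- The norm of the action of a matrix on alternating `j`-forms. -/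
def compoundNorm (j : ℕ) (B : Matrix (Fin a) (Fin b) ℝ) : ℝ :=
  pullbackNorm j (Matrix.toEuclideanLin B).toContinuousLinearMap

lemma compoundNorm_nonneg (j : ℕ) (B : Matrix (Fin a) (Fin b) ℝ) : 0 ≤ compoundNorm j B :=
  pullbackNorm_nonneg _ _

lemma compoundNorm_mul_le (j : ℕ) (B : Matrix (Fin a) (Fin b) ℝ) (C : Matrix (Fin b) (Fin c) ℝ) :
    compoundNorm j (B * C) ≤ compoundNorm j B * compoundNorm j C := by
  have : (Matrix.toEuclideanLin (B * C)).toContinuousLinearMap =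
      (Matrix.toEuclideanLin B).toContinuousLinearMap ∘L
        (Matrix.toEuclideanLin C).toContinuousLinearMap := by
    ext v i
    simp [Matrix.toLpLin_apply]
  rw [compoundNorm, this]
  exact pullbackNorm_comp_le _ _ _

lemma compoundNorm_mul_mul_le (j : ℕ) (B : Matrix (Fin a) (Fin b) ℝ)
    (C : Matrix (Fin b) (Fin c) ℝ) (D : Matrix (Fin c) (Fin d) ℝ) :
    compoundNorm j (B * C * D) ≤ compoundNorm j B * compoundNorm j C * compoundNorm j D :=
  (compoundNorm_mul_le _ _ _).trans
    (mul_le_mul_of_nonneg_right (compoundNorm_mul_le _ _ _) (compoundNorm_nonneg _ _))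

lemma singularValue_nonneg (B : Matrix (Fin d) (Fin d) ℝ) (i : ℕ) : 0 ≤ singularValue B i :=
  LinearMap.singularValues_nonneg _ _

lemma prod_singularValue_le (j : ℕ) (B : Matrix (Fin d) (Fin d) ℝ) :
    ∏ i ∈ Finset.range j, singularValue B i ≤ (j.factorial : ℝ) * compoundNorm j B :=
  prod_singularValues_le_pullbackNorm j (Matrix.toEuclideanLin B).toContinuousLinearMap

/-- The summand 1 keeps the constant positive when d = 0, as the comparison of logarithms requires.
-/
lemma compoundNorm_le_prod (j : ℕ) (B : Matrix (Fin d) (Fin d) ℝ) :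
    compoundNorm j B ≤ ((d : ℝ) ^ j + 1) * ∏ i ∈ Finset.range j, singularValue B i := by
  have h := pullbackNorm_le_prod_singularValues j (Matrix.toEuclideanLin B).toContinuousLinearMap
  rw [finrank_euclideanSpace_fin] at h
  refine h.trans (mul_le_mul_of_nonneg_right (by linarith) ?_)
  exact Finset.prod_nonneg fun i _ => singularValue_nonneg B i

lemma compoundNorm_pos {B : Matrix (Fin d) (Fin d) ℝ} (hB : IsUnit B) {j : ℕ} (hj : j ≤ d) :
    0 < compoundNorm j B := by
  have hinj : Function.Injective (Matrix.toEuclideanLin B) := by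
    intro v w h
    have h' : B.mulVec v.ofLp = B.mulVec w.ofLp := by
      simpa [Matrix.toLpLin_apply] using h
    exact WithLp.ofLp_injective 2 (Matrix.mulVec_injective_iff_isUnit.2 hB h')
  have hpos := (LinearMap.injective_iff_forall_lt_finrank_singularValues_pos _).1 hinj
  rw [finrank_euclideanSpace_fin] at hpos
  have h1 : 0 < ∏ i ∈ Finset.range j, singularValue B i :=
    Finset.prod_pos fun i hi => hpos i ((Finset.mem_range.1 hi).trans_le hj)
  exact pos_of_mul_pos_right (h1.trans_le (prod_singularValue_le j B)) (by positivity)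

/-- The growth rates of the norms on alternating forms determine those of the singular values. -/
lemma tendsto_log_singularValue {B : ℕ → Matrix (Fin d) (Fin d) ℝ} {i : ℕ} {l l' : ℝ}
    (hpos : ∀ᶠ n in atTop, 0 < compoundNorm i (B n))
    (hpos' : ∀ᶠ n in atTop, 0 < compoundNorm (i + 1) (B n))
    (h : Tendsto (fun n : ℕ => Real.log (compoundNorm i (B n)) / n) atTop (𝓝 l))
    (h' : Tendsto (fun n : ℕ => Real.log (compoundNorm (i + 1) (B n)) / n) atTop (𝓝 l')) :
    Tendsto (fun n : ℕ => ENNReal.log (ENNReal.ofReal (singularValue (B n) i)) / (n : EReal))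
      atTop (𝓝 ((l' - l : ℝ) : EReal)) := by
  have key : ∀ {j : ℕ} {l : ℝ}, (∀ᶠ n in atTop, 0 < compoundNorm j (B n)) →
      Tendsto (fun n : ℕ => Real.log (compoundNorm j (B n)) / n) atTop (𝓝 l) →
      Tendsto (fun n : ℕ => Real.log (∏ i ∈ Finset.range j, singularValue (B n) i) / n)
        atTop (𝓝 l) := fun {j l} hp hl =>
    tendsto_log_div_of_comparable (c := (d : ℝ) ^ j + 1) (by positivity) hp
      (Eventually.of_forall fun n => compoundNorm_le_prod j (B n))
      (Eventually.of_forall fun n => prod_singularValue_le j (B n)) hl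
  -- The logarithm of one singular value is the difference of the logarithms of two consecutive
  -- products.
  have hreal := (key hpos' h').sub (key hpos h)
  refine (continuous_coe_real_ereal.continuousAt.tendsto.comp hreal).congr' ?_
  filter_upwards [hpos'] with n hn
  have hprod : 0 < ∏ i ∈ Finset.range (i + 1), singularValue (B n) i :=
    pos_of_mul_pos_right (hn.trans_le (compoundNorm_le_prod _ _)) (by positivity)
  rw [Finset.prod_range_succ] at hprod
  have h0 : 0 ≤ ∏ i ∈ Finset.range i, singularValue (B n) i :=
    Finset.prod_nonneg fun i _ => singularValue_nonneg _ i
  have hs : 0 < singularValue (B n) i := pos_of_mul_pos_right hprod h0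
  have hP : 0 < ∏ i ∈ Finset.range i, singularValue (B n) i := pos_of_mul_pos_left hprod hs.le
  rw [Function.comp_apply, Finset.prod_range_succ, Real.log_mul hP.ne' hs.ne', ← sub_div,
    add_sub_cancel_left, ENNReal.log_ofReal_of_pos hs, EReal.coe_div]
  rfl

end CompoundNorm

/-! ### Iterates of a cocycle -/

section Iterates

variable {X : Type*} {d : ℕ}

lemma iter_add (T : X → X) (A : X → Matrix (Fin d) (Fin d) ℝ) (a b : ℕ) (x : X) :
    iter T A (a + b) x = iter T A b (T^[a] x) * iter T A a x := by
  induction b with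
  | zero => simp [iter]
  | succ b ih =>
    rw [← add_assoc, iter, ih, iter, ← mul_assoc, ← Function.iterate_add_apply, add_comm b a]

lemma iter_succ' (T : X → X) (A : X → Matrix (Fin d) (Fin d) ℝ) (n : ℕ) (x : X) :
    iter T A (n + 1) x = iter T A n (T x) * A x := by
  rw [add_comm n 1, iter_add]
  simp [iter]

lemma isUnit_iter {T : X → X} {A : X → Matrix (Fin d) (Fin d) ℝ} (hA : ∀ x, IsUnit (A x))
    (n : ℕ) (x : X) : IsUnit (iter T A n x) := by
  induction n with
  | zero => exact isUnit_one
  | succ n ih => exact (hA _).mul ih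

end Iterates

/-! ### Invertible cocycles depending on two symbols -/

section MarkovCocycle

variable {m k : ℕ} {C : Fin m → Fin m → Matrix (Fin k) (Fin k) ℝ}

lemma dependsOn_iter (C : Fin m → Fin m → Matrix (Fin k) (Fin k) ℝ) (n : ℕ) :
    DependsOn (iter shift (fun ω : ℕ → Fin m => C (ω 1) (ω 0)) n) (Set.Iic n) := by
  induction n with
  | zero => exact fun _ _ _ => rfl
  | succ n ih =>
    intro ω ω' h
    have h1 := ih fun i hi => h i (Set.Iic_subset_Iic.2 n.le_succ hi)
    have h2 : ω (0 + n) = ω' (0 + n) := h _ (by simp)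
    have h3 : ω (1 + n) = ω' (1 + n) := h _ (by simp [add_comm])
    simp only [iter, h1, shift_iterate_apply]
    rw [h2, h3]

/-- Multiplying by a value of the cocycle or by its inverse changes the logarithm by a bounded
amount, uniformly because the alphabet is finite. -/
lemma exists_isBoundedSubadditive_log_compoundNorm (hC : ∀ i j, IsUnit (C i j)) {j : ℕ}
    (hj : j ≤ k) : ∃ K, IsBoundedSubadditive (fun n ω => Real.log (compoundNorm j
      (iter shift (fun ω : ℕ → Fin m => C (ω 1) (ω 0)) n ω))) K := by
  set B : (ℕ → Fin m) → Matrix (Fin k) (Fin k) ℝ := fun ω => C (ω 1) (ω 0) with hB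
  have hBu : ∀ ω, IsUnit (B ω) := fun ω => hC _ _
  have hpos : ∀ n ω, 0 < compoundNorm j (iter shift B n ω) :=
    fun n ω => compoundNorm_pos (isUnit_iter hBu n ω) hj
  obtain ⟨K₁, hK₁⟩ := Finite.exists_le
    fun q : Fin m × Fin m => Real.log (compoundNorm j (C q.1 q.2))
  obtain ⟨K₂, hK₂⟩ := Finite.exists_le
    fun q : Fin m × Fin m => Real.log (compoundNorm j (C q.1 q.2)⁻¹)
  set K₃ := |Real.log (compoundNorm j (1 : Matrix (Fin k) (Fin k) ℝ))|
  refine ⟨max (max K₁ K₂) K₃, ⟨fun a b ω => ?_, fun n ω => ?_, fun ω => le_max_right _ _,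
    fun n => ?_⟩⟩
  · rw [iter_add, ← Real.log_mul (hpos _ _).ne' (hpos _ _).ne', mul_comm]
    refine Real.log_le_log ?_ (compoundNorm_mul_le _ _ _)
    rw [← iter_add]
    exact hpos _ _
  · have hCpos := compoundNorm_pos (hBu ω) hj
    have hCinv : IsUnit (B ω)⁻¹ := by
      rw [Matrix.isUnit_nonsing_inv_iff]
      exact hBu ω
    have hCpos' := compoundNorm_pos hCinv hj
    have e : iter shift B n (shift ω) = iter shift B (n + 1) ω * (B ω)⁻¹ := by
      rw [iter_succ', mul_assoc, Matrix.mul_nonsing_inv _ ((Matrix.isUnit_iff_isUnit_det _).1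
        (hBu ω)), mul_one]
    have h1 : Real.log (compoundNorm j (iter shift B (n + 1) ω)) ≤
        Real.log (compoundNorm j (iter shift B n (shift ω))) + Real.log (compoundNorm j (B ω)) := by
      rw [← Real.log_mul (hpos _ _).ne' hCpos.ne']
      refine Real.log_le_log (hpos _ _) ?_
      rw [iter_succ']
      exact compoundNorm_mul_le _ _ _
    have h2 : Real.log (compoundNorm j (iter shift B n (shift ω))) ≤
        Real.log (compoundNorm j (iter shift B (n + 1) ω)) +
          Real.log (compoundNorm j (B ω)⁻¹) := by
      rw [← Real.log_mul (hpos _ _).ne' hCpos'.ne']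
      refine Real.log_le_log (hpos _ _) ?_
      rw [e]
      exact compoundNorm_mul_le _ _ _
    have h3 : Real.log (compoundNorm j (B ω)) ≤ max (max K₁ K₂) K₃ :=
      (hK₁ (ω 1, ω 0)).trans ((le_max_left _ _).trans (le_max_left _ _))
    have h4 : Real.log (compoundNorm j (B ω)⁻¹) ≤ max (max K₁ K₂) K₃ :=
      (hK₂ (ω 1, ω 0)).trans ((le_max_right _ _).trans (le_max_left _ _))
    exact abs_le.2 ⟨by linarith, by linarith⟩
  · intro ω ω' h
    simp only [dependsOn_iter C n h, hB]

end MarkovCocycle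

/-! ### Comparison of the original and reduced cocycles -/

section ReducedCocycle

variable {m d k : ℕ} {A : Fin m → Matrix (Fin d) (Fin d) ℝ} {M : Fin m → Matrix (Fin d) (Fin k) ℝ}

/-- Each column of `A i` has the form `M i` w, and (M i)ᵗ (M i) = 1. -/
lemma IsRangeFrame.mul_transpose_mul (hM : IsRangeFrame A M) (i : Fin m) :
    M i * (M i).transpose * A i = A i := by
  refine Matrix.ext_of_mulVec_single fun j => ?_
  obtain ⟨w, hw⟩ : (A i).mulVec (Pi.single j 1) ∈ LinearMap.range (M i).mulVecLin := by
    rw [hM.range_eq i]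
    exact ⟨Pi.single j 1, rfl⟩
  rw [Matrix.mulVecLin_apply] at hw
  rw [← Matrix.mulVec_mulVec, ← hw, Matrix.mulVec_mulVec, Matrix.mul_assoc, hM.orthogonal i,
    Matrix.mul_one]

lemma IsRangeFrame.mul_reducedMatrix (hM : IsRangeFrame A M) (i j : Fin m) :
    M i * reducedMatrix A M i j = A i * M j := by
  rw [reducedMatrix, ← Matrix.mul_assoc, ← Matrix.mul_assoc, hM.mul_transpose_mul]

open scoped Matrix.Norms.L2Operator in
-- `A i * A j` factors through ℝ^k as M_i C_{i,j} (M_jᵗ A_j), so each of its k × k minors is a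
-- product of three determinants, including det C_{i,j}. Positivity of Θ_k provides a nonzero minor.
lemma IsRangeFrame.isUnit_reducedMatrix (hM : IsRangeFrame A M) (hTheta : 0 < theta k A)
    (i j : Fin m) : IsUnit (reducedMatrix A M i j) := by
  have hne : exteriorPower k (A i * A j) ≠ 0 := by
    intro h0
    have h1 : theta k A ≤ _ := ciInf_le (Set.finite_range _).bddBelow (i, j)
    simp only [h0, norm_zero] at h1
    linarith
  obtain ⟨I, J, hIJ⟩ : ∃ I J, exteriorPower k (A i * A j) I J ≠ 0 := by
    by_contra! h
    exact hne (Matrix.ext h)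
  have hfac : A i * A j = M i * (reducedMatrix A M i j * ((M j).transpose * A j)) := by
    rw [← Matrix.mul_assoc, hM.mul_reducedMatrix, Matrix.mul_assoc, ← Matrix.mul_assoc (M j),
      hM.mul_transpose_mul]
  rw [Matrix.isUnit_iff_isUnit_det, isUnit_iff_ne_zero]
  intro hdet
  apply hIJ
  have hsub : (A i * A j).submatrix (I.1.orderEmbOfFin I.2) (J.1.orderEmbOfFin J.2) =
      (M i).submatrix (I.1.orderEmbOfFin I.2) id * (reducedMatrix A M i j *
        ((M j).transpose * A j).submatrix id (J.1.orderEmbOfFin J.2)) := by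
    rw [hfac]
    rfl
  simp only [exteriorPower, Matrix.of_apply]
  rw [hsub, Matrix.det_mul, Matrix.det_mul, hdet, zero_mul, mul_zero]

/-- The iterates of the two cocycles are intertwined by the frames. -/
lemma IsRangeFrame.iter_shift_mul (hM : IsRangeFrame A M) (n : ℕ) (ω : ℕ → Fin m) :
    iter shift (randomCocycle A) n (shift ω) * M (ω 0) =
      M (ω n) * iter shift (reducedCocycle A M) n ω := by
  induction n with
  | zero => simp [iter]
  | succ n ih =>
    rw [iter, Matrix.mul_assoc, ih, iter, ← Matrix.mul_assoc, ← Matrix.mul_assoc]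
    congr 1
    rw [randomCocycle, reducedCocycle, ← Function.iterate_succ_apply, shift_iterate_apply,
      shift_iterate_apply, shift_iterate_apply, zero_add, zero_add, add_comm 1 n,
      hM.mul_reducedMatrix]

lemma IsRangeFrame.iter_succ_eq (hM : IsRangeFrame A M) (n : ℕ) (ω : ℕ → Fin m) :
    iter shift (randomCocycle A) (n + 1) ω =
      M (ω n) * iter shift (reducedCocycle A M) n ω * ((M (ω 0)).transpose * A (ω 0)) := by
  rw [iter_succ', ← hM.iter_shift_mul, Matrix.mul_assoc, ← Matrix.mul_assoc (M (ω 0)),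
    hM.mul_transpose_mul, randomCocycle]

/-- M_{ω_0} C_{ω_0,ω_0}⁻¹ is a right inverse of M_{ω_0}ᵗ A_{ω_0}, and M_{ω_n} has its transpose as a
left inverse, so the previous factorization can be solved for C^n. -/
lemma IsRangeFrame.iter_reduced_eq (hM : IsRangeFrame A M)
    (hC : ∀ i j, IsUnit (reducedMatrix A M i j)) (n : ℕ) (ω : ℕ → Fin m) :
    iter shift (reducedCocycle A M) n ω = (M (ω n)).transpose *
      iter shift (randomCocycle A) (n + 1) ω * (M (ω 0) * (reducedMatrix A M (ω 0) (ω 0))⁻¹) := by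
  have h : (M (ω n)).transpose * (M (ω n) * iter shift (reducedCocycle A M) n ω *
      ((M (ω 0)).transpose * A (ω 0))) * (M (ω 0) * (reducedMatrix A M (ω 0) (ω 0))⁻¹) =
      (M (ω n)).transpose * M (ω n) * iter shift (reducedCocycle A M) n ω *
        ((M (ω 0)).transpose * A (ω 0) * M (ω 0) * (reducedMatrix A M (ω 0) (ω 0))⁻¹) := by
    simp only [Matrix.mul_assoc]
  rw [hM.iter_succ_eq, h, hM.orthogonal, Matrix.one_mul, ← reducedMatrix,
    Matrix.mul_nonsing_inv _ ((Matrix.isUnit_iff_isUnit_det _).1 (hC _ _)), Matrix.mul_one]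

lemma IsRangeFrame.semiconj (hM : IsRangeFrame A M) :
    Function.Semiconj (semiconjugacy M)
      (skewProduct shift (reducedCocycle A M)) (skewProduct shift (randomCocycle A)) := by
  rintro ⟨ω, v⟩
  simp only [semiconjugacy, skewProduct, Matrix.mulVec_mulVec, reducedCocycle, randomCocycle]
  change (_, (M (ω 1) * reducedMatrix A M (ω 1) (ω 0)).mulVec v) = _
  rw [hM.mul_reducedMatrix]
  rfl

/-- The two cocycles have the same growth rates on alternating forms. -/
lemma IsRangeFrame.tendsto_log_compoundNorm (hM : IsRangeFrame A M)
    (hC : ∀ i j, IsUnit (reducedMatrix A M i j)) {j : ℕ} (hj : j ≤ k) {ω : ℕ → Fin m} {l : ℝ}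
    (h : Tendsto (fun n : ℕ => Real.log (compoundNorm j
      (iter shift (reducedCocycle A M) n ω)) / n) atTop (𝓝 l)) :
    (∀ᶠ n in atTop, 0 < compoundNorm j (iter shift (randomCocycle A) n ω)) ∧
    Tendsto (fun n : ℕ => Real.log (compoundNorm j
      (iter shift (randomCocycle A) n ω)) / n) atTop (𝓝 l) := by
  have hpos : ∀ n, 0 < compoundNorm j (iter shift (reducedCocycle A M) n ω) :=
    fun n => compoundNorm_pos (isUnit_iter (fun _ => hC _ _) n ω) hj
  obtain ⟨D, hD⟩ := Finite.exists_le fun i : Fin m => compoundNorm j (M i)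
  obtain ⟨D', hD'⟩ := Finite.exists_le fun i : Fin m => compoundNorm j (M i).transpose
  have hD0 : 0 ≤ D' := (compoundNorm_nonneg _ _).trans (hD' (ω 0))
  set b := compoundNorm j ((M (ω 0)).transpose * A (ω 0))
  set b' := compoundNorm j (M (ω 0) * (reducedMatrix A M (ω 0) (ω 0))⁻¹)
  have hb : 0 ≤ b := compoundNorm_nonneg _ _
  have hb' : 0 ≤ b' := compoundNorm_nonneg _ _
  have hA0 : ∀ n, 0 ≤ compoundNorm j (iter shift (randomCocycle A) n ω) :=
    fun n => compoundNorm_nonneg _ _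
  have hup : ∀ n, compoundNorm j (iter shift (randomCocycle A) (n + 1) ω) ≤
      (D * b) * compoundNorm j (iter shift (reducedCocycle A M) n ω) := by
    intro n
    have h1 := compoundNorm_mul_mul_le j (M (ω n)) (iter shift (reducedCocycle A M) n ω)
      ((M (ω 0)).transpose * A (ω 0))
    rw [← hM.iter_succ_eq] at h1
    refine h1.trans ((mul_le_mul_of_nonneg_right
      (mul_le_mul_of_nonneg_right (hD (ω n)) (hpos n).le) hb).trans (le_of_eq ?_))
    ring
  -- The added 1 makes the constant positive without a separate argument.
  have hlow : ∀ n, compoundNorm j (iter shift (reducedCocycle A M) n ω) ≤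
      (D' * b' + 1) * compoundNorm j (iter shift (randomCocycle A) (n + 1) ω) := by
    intro n
    have h1 := compoundNorm_mul_mul_le j (M (ω n)).transpose
      (iter shift (randomCocycle A) (n + 1) ω) (M (ω 0) * (reducedMatrix A M (ω 0) (ω 0))⁻¹)
    rw [← hM.iter_reduced_eq hC] at h1
    have h2 := mul_le_mul_of_nonneg_right
      (mul_le_mul_of_nonneg_right (hD' (ω n)) (hA0 (n + 1))) hb'
    have h3 := hA0 (n + 1)
    linarith
  have hc : 0 < D' * b' + 1 := by positivity
  refine ⟨?_, ?_⟩
  · filter_upwards [eventually_ge_atTop 1] with n hn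
    obtain ⟨q, rfl⟩ := Nat.exists_eq_add_of_le' hn
    exact pos_of_mul_pos_right ((hpos q).trans_le (hlow q)) hc.le
  · exact tendsto_div_of_tendsto_succ_div (y := fun n => Real.log (compoundNorm j
      (iter shift (randomCocycle A) n ω))) (tendsto_log_div_of_comparable hc
        (Eventually.of_forall hpos) (Eventually.of_forall hlow) (Eventually.of_forall hup) h)

end ReducedCocycle

end ConstRank

end

/-! ### Equality of the Lyapunov exponents -/

open ConstRank in
theorem proposition4p5 {m d k : ℕ} (p : stdSimplex ℝ (Fin m)) (hp : ∀ j, 0 < p.1 j)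
    (A : Fin m → Matrix (Fin d) (Fin d) ℝ) (hrank : ∀ j, (A j).rank = k)
    (hTheta : 0 < theta k A)
    (M : Fin m → Matrix (Fin d) (Fin k) ℝ) (hM : IsRangeFrame A M) :
    (∀ i j, IsUnit (reducedMatrix A M i j)) ∧
    Function.Semiconj (semiconjugacy M)
      (skewProduct shift (reducedCocycle A M)) (skewProduct shift (randomCocycle A)) ∧
    ∀ i < k, ∃ L : EReal,
      IsLyapunovExponent (bernoulli p) shift (randomCocycle A) i L ∧
      IsLyapunovExponent (bernoulli p) shift (reducedCocycle A M) i L := by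
  have hC := hM.isUnit_reducedMatrix hTheta
  refine ⟨hC, hM.semiconj, fun i hi => ?_⟩
  have hlim : ∀ {j : ℕ}, j ≤ k → ∃ l : ℝ, ∀ᵐ ω ∂bernoulli p, Tendsto (fun n : ℕ =>
      Real.log (compoundNorm j (iter shift (reducedCocycle A M) n ω)) / n) atTop (𝓝 l) := by
    intro j hj
    obtain ⟨K, hK⟩ := exists_isBoundedSubadditive_log_compoundNorm hC hj
    exact hK.exists_ae_tendsto p
  have hpos : ∀ {j : ℕ}, j ≤ k → ∀ ω, ∀ᶠ n in atTop,
      0 < compoundNorm j (iter shift (reducedCocycle A M) n ω) := fun hj ω =>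
    Eventually.of_forall fun n => compoundNorm_pos (isUnit_iter (fun _ => hC _ _) n ω) hj
  obtain ⟨l, hl⟩ := hlim hi.le
  obtain ⟨l', hl'⟩ := hlim (Nat.succ_le_of_lt hi)
  -- Index i counts from 0, so the exponent is the rate on (i + 1)-forms minus the rate on i-forms;
  -- both exist as i + 1 ≤ k.
  refine ⟨((l' - l : ℝ) : EReal), ?_, ?_⟩
  · filter_upwards [hl, hl'] with ω h h'
    obtain ⟨h1, h2⟩ := hM.tendsto_log_compoundNorm hC hi.le h
    obtain ⟨h3, h4⟩ := hM.tendsto_log_compoundNorm hC (Nat.succ_le_of_lt hi) h'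
    exact tendsto_log_singularValue h1 h3 h2 h4
  · filter_upwards [hl, hl'] with ω h h'
    exact tendsto_log_singularValue (hpos hi.le ω) (hpos (Nat.succ_le_of_lt hi) ω) h h'
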